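/- Let $\mathfrak{A}$ be a unital $C^*$-algebra and let $H=H^*\in\mathfrak{A}$. A state is a positive linear functional $\omega:\mathfrak{A}\to\mathbb{C}$ with $\omega(\mathbf{1})=1$; it is pure if the only positive linear functionals $\rho$ on $\mathfrak{A}$ for which $\omega-\rho$ is positive are the multiples $t\omega$ with $0\le t\le 1$. Let $(\pi_\omega,\mathcal{H}_\omega,\psi_\omega)$ denote the GNS representation of a state $\omega$. The state $\omega$ is called a ground state for $H$ if $\omega(H)=\min\operatorname{Spec}(\pi_\omega(H))$. Put $\delta_H(A):=i[H,A]=i(HA-AH)$ for $A\in\mathfrak{A}$. If $\omega$ is a ground state for $H$, then $$-i\,\omega\big(A^*\delta_H(A)\big)\;\ge\;0\qquad\text{for all }A\in\mathfrak{A},\tag{1}$$ that is, the left-hand side is real and non-negative. Conversely, if $\omega$ is a pure state which satisfies (1), then $\omega$ is a ground state for $H$. -/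

import Mathlib

open scoped ComplexOrder

namespace CStarGround

variable {A : Type*} [CStarAlgebra A] [PartialOrder A]

/-- A state of the unital C*-algebra `A`: a positive linear functional `ω` with `ω 1 = 1`. -/
def IsState (ω : A →ₚ[ℂ] ℂ) : Prop :=
  ω 1 = 1

/-- A state `ω` is pure if the only positive linear functionals `ρ` majorized by `ω`
(that is, such that `ω - ρ` is positive) are the multiples `t ω` with `0 ≤ t ≤ 1`. -/
def IsPureState (ω : A →ₚ[ℂ] ℂ) : Prop :=
  IsState ω ∧
    ∀ ρ : A →ₚ[ℂ] ℂ, (∀ a : A, 0 ≤ a → ρ a ≤ ω a) →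
      ∃ t : ℝ, 0 ≤ t ∧ t ≤ 1 ∧ ∀ a : A, ρ a = (t : ℂ) * ω a

/-- The derivation `δ_H(a) = i [H, a]`. -/
noncomputable def delta (H a : A) : A :=
  Complex.I • (H * a - a * H)

/-- A state `ω` is a ground state for `H` if `ω(H)` is the minimum of the spectrum of `π_ω(H)`,
where `π_ω` is the GNS representation of `ω` on its GNS Hilbert space. It is meant for
self-adjoint `H`, for which this spectrum is contained in the real line. -/
def IsGroundState [StarOrderedRing A] (H : A) (ω : A →ₚ[ℂ] ℂ) : Prop :=
  IsState ω ∧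
    ∃ m : ℝ, IsLeast {x : ℝ | (x : ℂ) ∈ spectrum ℂ (ω.gnsStarAlgHom H)} m ∧ ω H = (m : ℂ)

/-- The condition `-i ω(a* δ_H(a)) ≥ 0` for all `a` (the left-hand side is real and
non-negative). -/
def GroundInequality (H : A) (ω : A →ₚ[ℂ] ℂ) : Prop :=
  ∀ a : A, 0 ≤ -Complex.I * ω (star a * delta H a)

end CStarGround

open scoped InnerProductSpace

/-!
The commutator expectation `-i ω(a* δ_H(a))` equals `ω(a*Ha) - ω(a*aH)`. If the cyclic vector
`ψ` of the GNS representation `π` is an eigenvector of `π(H)` with eigenvalue `m`, in the form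
`ω(aH) = m ω(a)` for all `a`, then this is `ω(a*(H - m)a)`, the quadratic form of `π(H) - m` at
`π(a)ψ`. These vectors are dense, so under the eigenvector condition the ground state inequality
says exactly that `π(H) ≥ m`, that is, that the spectrum of `π(H)` lies in `[m, ∞)`
(`mem_lowerBounds_spectrum_gnsStarAlgHom_iff`). Both directions thus reduce to proving the
eigenvector condition.

For a ground state, `π(H) - m` is positive with vanishing expectation in `ψ`, hence is of the form
`R*R` with `Rψ = 0`, and so annihilates `ψ` (`apply_mul_eq_zero_of_forall_nonneg`).

For a pure state, the reality of the expression in the inequality already gives `ω(Ha) = ω(aH)` for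
all `a`. The set of all such `H` is a closed star subalgebra, the centralizer of `ω`, so it is
stable under the continuous functional calculus. If `0 ≤ t ≤ 1` is in the centralizer, then
`ω(at) = ω(√t a √t)`, so `a ↦ ω(at)` is a positive functional, and likewise for `1 - t`. Purity
makes it a multiple of `ω`; rescaling `H` to such a `t` gives the eigenvector condition
(`IsPureState.apply_mul_of_mem_functionalCentralizer`).
-/

namespace CStarGround

variable {A : Type*} [CStarAlgebra A] [PartialOrder A]

/-- The factors `-i` and `i` cancel, so the ground state inequality concerns `ω(a*[H, a])`. -/
lemma neg_I_mul_apply_delta (H a : A) (ω : A →ₚ[ℂ] ℂ) :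
    -Complex.I * ω (star a * delta H a) = ω (star a * H * a) - ω (star a * a * H) := by
  have h : star a * delta H a = Complex.I • (star a * H * a - star a * a * H) := by
    simp only [delta, mul_smul_comm, mul_sub, mul_assoc]
  rw [h, map_smul, map_sub, smul_eq_mul, ← mul_assoc, neg_mul, Complex.I_mul_I, neg_neg, one_mul]

/-- When `ω(bH) = m ω(b)` for all `b`, that is, when the cyclic vector is an eigenvector of
`π_ω(H)` with eigenvalue `m`, the commutator expectation is the quadratic form of
`π_ω(H) - m`. -/
lemma neg_I_mul_apply_delta_of_eigenvector {ω : A →ₚ[ℂ] ℂ} {H : A} {m : ℝ}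
    (h : ∀ b, ω (b * H) = m * ω b) (a : A) :
    -Complex.I * ω (star a * delta H a) = ω (star a * (H - algebraMap ℝ A m) * a) := by
  rw [neg_I_mul_apply_delta, h, mul_sub, sub_mul, map_sub, Algebra.algebraMap_eq_smul_one,
    mul_smul_comm, mul_one, smul_mul_assoc, ← Complex.coe_smul, map_smul, smul_eq_mul]

variable [StarOrderedRing A]

lemma gnsStarAlgHom_apply_coe (ω : A →ₚ[ℂ] ℂ) (b c : A) :
    ω.gnsStarAlgHom b (ω.toPreGNS c : ω.GNS) = (ω.toPreGNS (b * c) : ω.GNS) := by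
  simp

lemma inner_toPreGNS (ω : A →ₚ[ℂ] ℂ) (a b : A) :
    ⟪(ω.toPreGNS a : ω.GNS), (ω.toPreGNS b : ω.GNS)⟫_ℂ = ω (star a * b) := by
  rw [UniformSpace.Completion.inner_coe, PositiveLinearMap.preGNS_inner_def]
  simp

/-- Positivity of an operator `π_ω(b)` can be tested on the dense subspace of vectors
`π_ω(a)ψ_ω`. -/
lemma gnsStarAlgHom_nonneg_iff (ω : A →ₚ[ℂ] ℂ) {b : A} (hb : IsSelfAdjoint b) :
    0 ≤ ω.gnsStarAlgHom b ↔ ∀ a, 0 ≤ ω (star a * b * a) := by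
  have key (a : A) : ⟪(ω.toPreGNS a : ω.GNS), ω.gnsStarAlgHom b (ω.toPreGNS a : ω.GNS)⟫_ℂ
      = ω (star a * b * a) := by
    rw [gnsStarAlgHom_apply_coe, inner_toPreGNS, mul_assoc]
  rw [ContinuousLinearMap.nonneg_iff_isPositive]
  refine ⟨fun h a ↦ key a ▸ h.inner_nonneg_right _, fun h ↦ ?_⟩
  have hs : IsSelfAdjoint (ω.gnsStarAlgHom b) := hb.map _
  refine (ContinuousLinearMap.isPositive_iff' _).2 ⟨hs, fun x ↦ ?_⟩
  induction x using UniformSpace.Completion.induction_on with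
  | hp => exact isClosed_le continuous_const (by fun_prop)
  | ih x =>
    rw [(ContinuousLinearMap.isSelfAdjoint_iff_isSymmetric.1 hs).apply_clm]
    exact (key (ω.ofPreGNS x)).symm ▸ h (ω.ofPreGNS x)

/-- The real points of the complex spectrum of a self-adjoint element are bounded below by `m`
exactly when the element dominates the scalar `m`. -/
lemma mem_lowerBounds_spectrum_iff {T : A} (hT : IsSelfAdjoint T) (m : ℝ) :
    m ∈ lowerBounds {x : ℝ | (x : ℂ) ∈ spectrum ℂ T} ↔ algebraMap ℝ A m ≤ T := by
  rw [algebraMap_le_iff_le_spectrum, mem_lowerBounds]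
  exact forall_congr' fun x ↦ imp_congr_left
    (show algebraMap ℝ ℂ x ∈ spectrum ℂ T ↔ x ∈ spectrum ℝ T from spectrum.algebraMap_mem_iff ℂ)

lemma mem_lowerBounds_spectrum_gnsStarAlgHom_iff (ω : A →ₚ[ℂ] ℂ) {H : A} (hH : IsSelfAdjoint H)
    (m : ℝ) :
    m ∈ lowerBounds {x : ℝ | (x : ℂ) ∈ spectrum ℂ (ω.gnsStarAlgHom H)} ↔
      ∀ a, 0 ≤ ω (star a * (H - algebraMap ℝ A m) * a) := by
  have hm : ω.gnsStarAlgHom (algebraMap ℝ A m) = algebraMap ℝ (ω.GNS →L[ℂ] ω.GNS) m := by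
    rw [IsScalarTower.algebraMap_apply ℝ ℂ A, AlgHomClass.commutes,
      ← IsScalarTower.algebraMap_apply]
  rw [mem_lowerBounds_spectrum_iff (hH.map _), ← hm, ← sub_nonneg, ← map_sub]
  exact gnsStarAlgHom_nonneg_iff ω (hH.sub (.algebraMap A (.all m)))

/-- If `π_ω(b)` is a positive operator with vanishing expectation in the cyclic vector, then it
annihilates that vector. -/
lemma apply_mul_eq_zero_of_forall_nonneg (ω : A →ₚ[ℂ] ℂ) {b : A} (hb : IsSelfAdjoint b)
    (h : ∀ a, 0 ≤ ω (star a * b * a)) (h0 : ω b = 0) (a : A) : ω (a * b) = 0 := by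
  obtain ⟨R, hR⟩ := CStarAlgebra.nonneg_iff_eq_star_mul_self.1
    ((gnsStarAlgHom_nonneg_iff ω hb).2 h)
  have hψ : R (ω.toPreGNS 1 : ω.GNS) = 0 := by
    rw [← inner_self_eq_zero (𝕜 := ℂ), ← ContinuousLinearMap.adjoint_inner_right,
      ← ContinuousLinearMap.star_eq_adjoint, ← mul_apply_eq_comp, ← hR,
      gnsStarAlgHom_apply_coe, inner_toPreGNS]
    simpa using h0
  have hb' : (ω.toPreGNS b : ω.GNS) = 0 := by
    rw [← mul_one b, ← gnsStarAlgHom_apply_coe, hR, mul_apply_eq_comp, hψ, map_zero]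
  rw [← star_star a, ← inner_toPreGNS, hb', inner_zero_right]

/-- The centralizer of a positive linear functional `ω`: the elements `s` for which
`ω(sa) = ω(as)` for every `a`. -/
noncomputable def functionalCentralizer (ω : A →ₚ[ℂ] ℂ) : StarSubalgebra ℂ A where
  carrier := {s | ∀ a, ω (s * a) = ω (a * s)}
  mul_mem' {s t} hs ht a := by rw [mul_assoc, hs, mul_assoc, ht, mul_assoc]
  add_mem' {s t} hs ht a := by rw [add_mul, mul_add, map_add, map_add, hs, ht]
  algebraMap_mem' r a := by rw [Algebra.commutes]
  star_mem' {s} hs a := by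
    have h := congrArg star (hs (star a))
    rw [← map_star, ← map_star, star_mul, star_mul, star_star] at h
    exact h.symm

lemma mem_functionalCentralizer {ω : A →ₚ[ℂ] ℂ} {s : A} :
    s ∈ functionalCentralizer ω ↔ ∀ a, ω (s * a) = ω (a * s) := Iff.rfl

instance isClosed_functionalCentralizer (ω : A →ₚ[ℂ] ℂ) :
    IsClosed (functionalCentralizer ω : Set A) := by
  have h : (functionalCentralizer ω : Set A) = ⋂ a, {s | ω (s * a) = ω (a * s)} := by
    ext s
    simp [mem_functionalCentralizer]
  have hω : Continuous ω := map_continuous ω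
  rw [h]
  exact isClosed_iInter fun a ↦ isClosed_eq (by fun_prop) (by fun_prop)

/-- For `t ≥ 0` in the centralizer, `√t` is in the centralizer as well, so
`ω(at) = ω(√t a √t)`. -/
lemma apply_mul_nonneg_of_mem_functionalCentralizer {ω : A →ₚ[ℂ] ℂ} {t : A} (ht : 0 ≤ t)
    (htω : t ∈ functionalCentralizer ω) {a : A} (ha : 0 ≤ a) : 0 ≤ ω (a * t) := by
  have hs : CFC.sqrt t ∈ functionalCentralizer ω := by
    rw [CFC.sqrt_eq_real_sqrt t]
    exact cfcₙ_mem (𝕜 := ℝ) (𝕜' := ℂ) _ htω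
  have h : ω (a * t) = ω (CFC.sqrt t * a * CFC.sqrt t) := by
    conv_lhs => rw [← CFC.sqrt_mul_sqrt_self t]
    rw [← mul_assoc, ← hs, ← mul_assoc]
  rw [h]
  exact ω.map_nonneg (conjugate_nonneg_of_nonneg ha (CFC.sqrt_nonneg t))

/-- If `0 ≤ t ≤ 1` lies in the centralizer of `ω`, then `a ↦ ω(at)` is a positive linear
functional majorized by `ω`, hence a multiple of `ω` when `ω` is pure. -/
lemma IsPureState.apply_mul_of_nonneg_of_le_one {ω : A →ₚ[ℂ] ℂ} (hω : IsPureState ω) {t : A}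
    (ht : 0 ≤ t) (ht1 : t ≤ 1) (htω : t ∈ functionalCentralizer ω) (a : A) :
    ω (a * t) = ω t * ω a := by
  obtain ⟨c, -, -, hc⟩ := hω.2
    (.mk₀ (ω.toLinearMap ∘ₗ LinearMap.mulRight ℂ t) fun a ha ↦
      apply_mul_nonneg_of_mem_functionalCentralizer ht htω ha) fun a ha ↦ by
    have h := apply_mul_nonneg_of_mem_functionalCentralizer (sub_nonneg.2 ht1)
      (sub_mem (one_mem _) htω) ha
    rw [mul_sub, mul_one, map_sub, sub_nonneg] at h
    exact h
  replace hc (a : A) : ω (a * t) = c * ω a := hc a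
  have h1 : ω t = c := by simpa [show ω 1 = 1 from hω.1] using hc 1
  rw [hc, h1]

/-- A pure state is multiplicative on the right against self-adjoint elements of its centralizer:
such an element is an affine function of a `t` with `0 ≤ t ≤ 1`. -/
lemma IsPureState.apply_mul_of_mem_functionalCentralizer {ω : A →ₚ[ℂ] ℂ} (hω : IsPureState ω)
    {H : A} (hH : IsSelfAdjoint H) (hHω : H ∈ functionalCentralizer ω) (a : A) :
    ω (a * H) = ω H * ω a := by
  -- The summand `1` keeps the scaling factor positive when `H = 0`.
  set r : ℝ := ‖H‖ + 1 with hr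
  have hr0 : 0 < r := by positivity
  have hmono : algebraMap ℝ A ‖H‖ ≤ algebraMap ℝ A r := algebraMap_mono A (by simp [hr])
  have hlo : 0 ≤ H + algebraMap ℝ A r := by
    rw [← neg_le_iff_add_nonneg]
    exact (neg_le_neg hmono).trans hH.neg_algebraMap_norm_le_self
  have hhi : H + algebraMap ℝ A r ≤ algebraMap ℝ A (2 * r) := by
    rw [two_mul, map_add (algebraMap ℝ A) r r]
    exact add_le_add (hH.le_algebraMap_norm_self.trans hmono) le_rfl
  set t : A := (2 * r)⁻¹ • (H + algebraMap ℝ A r) with ht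
  have ht0 : 0 ≤ t := smul_nonneg (by positivity) hlo
  have ht1 : t ≤ 1 := by
    have h := smul_le_smul_of_nonneg_left hhi (show 0 ≤ (2 * r)⁻¹ by positivity)
    rwa [Algebra.algebraMap_eq_smul_one (2 * r), smul_smul, inv_mul_cancel₀ (by positivity),
      one_smul] at h
  have hHt : H = ((2 * r : ℝ) : ℂ) • t - (r : ℂ) • (1 : A) := by
    rw [ht, Complex.coe_smul, Complex.coe_smul, smul_smul, mul_inv_cancel₀ (by positivity),
      one_smul, Algebra.algebraMap_eq_smul_one, add_sub_cancel_right]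
  have htω : t ∈ functionalCentralizer ω := by
    rw [ht, ← Complex.coe_smul, IsScalarTower.algebraMap_apply ℝ ℂ A]
    exact (functionalCentralizer ω).smul_mem (add_mem hHω (algebraMap_mem _ _)) _
  have h := hω.apply_mul_of_nonneg_of_le_one ht0 ht1 htω a
  clear_value t
  rw [hHt, mul_sub, mul_smul_comm, mul_smul_comm, mul_one]
  simp only [map_sub, map_smul, smul_eq_mul, h, show ω 1 = 1 from hω.1]
  ring

/-- The ground state inequality makes `ω(a*aH)` real, that is, `ω(Ha*a) = ω(a*aH)`; the positive
elements span the algebra. -/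
lemma GroundInequality.mem_functionalCentralizer {ω : A →ₚ[ℂ] ℂ} {H : A} (hH : IsSelfAdjoint H)
    (h : GroundInequality H ω) : H ∈ functionalCentralizer ω := by
  have hpos (b : A) (hb : 0 ≤ b) : ω (H * b) = ω (b * H) := by
    obtain ⟨a, rfl⟩ := CStarAlgebra.nonneg_iff_eq_star_mul_self.1 hb
    have h1 := (h a).isSelfAdjoint
    rw [neg_I_mul_apply_delta] at h1
    have h2 : IsSelfAdjoint (ω (star a * H * a)) := (hH.conjugate' a).map ω
    have h3 : IsSelfAdjoint (ω (star a * a * H)) := by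
      simpa using h2.sub h1
    rw [← h3.star_eq, ← map_star, star_mul, hH.star_eq, star_mul, star_star]
  intro a
  obtain ⟨x, hx, -, rfl⟩ := CStarAlgebra.exists_sum_four_nonneg a
  simp only [Finset.mul_sum, Finset.sum_mul, map_sum, mul_smul_comm, smul_mul_assoc, map_smul,
    hpos _ (hx _)]

lemma IsGroundState.groundInequality {ω : A →ₚ[ℂ] ℂ} {H : A} (hH : IsSelfAdjoint H)
    (h : IsGroundState H ω) : GroundInequality H ω := by
  obtain ⟨hω, m, hm, hHm⟩ := h
  have hpos := (mem_lowerBounds_spectrum_gnsStarAlgHom_iff ω hH m).1 hm.2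
  have hmap : ω (algebraMap ℝ A m) = m := by
    rw [Algebra.algebraMap_eq_smul_one, ← Complex.coe_smul, map_smul, show ω 1 = 1 from hω,
      smul_eq_mul, mul_one]
  have heig (b : A) : ω (b * H) = m * ω b := by
    have h0 := apply_mul_eq_zero_of_forall_nonneg ω (hH.sub (.algebraMap A (.all m))) hpos
      (by rw [map_sub, hmap, hHm, sub_self]) b
    rwa [mul_sub, map_sub, sub_eq_zero, Algebra.algebraMap_eq_smul_one, mul_smul_comm, mul_one,
      ← Complex.coe_smul, map_smul, smul_eq_mul] at h0
  intro a
  rw [neg_I_mul_apply_delta_of_eigenvector heig]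
  exact hpos a

/-- If `ω(aH) = m ω(a)` for all `a`, then `π_ω(H)ψ_ω = mψ_ω`, so `m` is in the spectrum. -/
lemma mem_spectrum_gnsStarAlgHom_of_eigenvector {ω : A →ₚ[ℂ] ℂ} (hω : IsState ω) {H : A} {m : ℝ}
    (h : ∀ a, ω (a * H) = m * ω a) : (m : ℂ) ∈ spectrum ℂ (ω.gnsStarAlgHom H) := by
  set ψ : ω.GNS := (ω.toPreGNS 1 : ω.GNS) with hψ
  have hψ0 : ψ ≠ 0 := by
    rw [← inner_self_ne_zero (𝕜 := ℂ), hψ, inner_toPreGNS, star_one, one_mul,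
      show ω 1 = 1 from hω]
    exact one_ne_zero
  have hker : (algebraMap ℂ (ω.GNS →L[ℂ] ω.GNS) m - ω.gnsStarAlgHom H) ψ = 0 := by
    have hsub : (algebraMap ℂ (ω.GNS →L[ℂ] ω.GNS) m - ω.gnsStarAlgHom H) ψ
        = (ω.toPreGNS (algebraMap ℂ A m - H) : ω.GNS) := by
      rw [← AlgHomClass.commutes ω.gnsStarAlgHom, ← map_sub, hψ, gnsStarAlgHom_apply_coe, mul_one]
    rw [hsub, ← inner_self_eq_zero (𝕜 := ℂ), inner_toPreGNS, mul_sub, map_sub, h,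
      Algebra.algebraMap_eq_smul_one, mul_smul_comm, mul_one, map_smul, smul_eq_mul, sub_self]
  rw [spectrum.mem_iff]
  intro hu
  obtain ⟨u, hu⟩ := hu
  apply hψ0
  rw [← hu] at hker
  calc ψ = (↑u⁻¹ * ↑u : ω.GNS →L[ℂ] ω.GNS) ψ := by rw [Units.inv_mul, one_apply_eq_self]
    _ = 0 := by rw [mul_apply_eq_comp, hker, map_zero]

lemma IsPureState.isGroundState {ω : A →ₚ[ℂ] ℂ} {H : A} (hH : IsSelfAdjoint H)
    (hω : IsPureState ω) (h : GroundInequality H ω) : IsGroundState H ω := by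
  obtain ⟨m, hm⟩ : ∃ m : ℝ, ω H = m :=
    ⟨(ω H).re, (Complex.conj_eq_iff_re.1 (hH.map ω).star_eq).symm⟩
  have heig (a : A) : ω (a * H) = m * ω a := by
    rw [← hm, hω.apply_mul_of_mem_functionalCentralizer hH (h.mem_functionalCentralizer hH)]
  refine ⟨hω.1, m, ⟨mem_spectrum_gnsStarAlgHom_of_eigenvector hω.1 heig, ?_⟩, hm⟩
  rw [mem_lowerBounds_spectrum_gnsStarAlgHom_iff ω hH]
  intro a
  rw [← neg_I_mul_apply_delta_of_eigenvector heig]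
  exact h a

end CStarGround

theorem mainTheorem7 {A : Type*} [CStarAlgebra A] [PartialOrder A] [StarOrderedRing A]
    (H : A) (hH : IsSelfAdjoint H) (ω : A →ₚ[ℂ] ℂ) :
    (CStarGround.IsGroundState H ω → CStarGround.GroundInequality H ω) ∧
      (CStarGround.IsPureState ω → CStarGround.GroundInequality H ω →
        CStarGround.IsGroundState H ω) :=
  ⟨fun h ↦ h.groundInequality hH, fun hω h ↦ hω.isGroundState hH h⟩
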